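/- **Theorem.** Let $\beta>3$, $w_0>0$ and $\lambda>0$ be constants. For $n,d\in\mathbb N$ with $d\ge 1$, let $G=\mathrm{GIRG}(n,\beta,w_0,d)$ be the standard geometric inhomogeneous random graph: each of the $n$ vertices $v$ independently receives a weight $w_v$ with the Pareto law $\Pr[w_v\le x]=1-(x/w_0)^{1-\beta}$ for $x\ge w_0$ and, independently of the weights, an independent uniformly distributed position $\mathbf x_v$ in the torus $\mathbb T^d=(\mathbb R/\mathbb Z)^d$; two distinct vertices $u,v$ are adjacent if and only if $$\max_{1\le i\le d}|\mathbf x_{ui}-\mathbf x_{vi}|_C\;\le\; \frac12\left(\frac{\lambda w_uw_v}{n}\right)^{1/d},$$ where $|\cdot|_C$ denotes the distance on the circle of length $1$. Let $\omega(G)$ be the clique number of $G$. There is a constant $C>0$, depending only on $\beta$, $w_0$ and $\lambda$, such that for every function $d=d(n)\ge 1$ with $d(n)=o(\log n)$, $$\Pr\left[\omega(G)\le C\,\frac{\log n}{d(n)+\log\log n}\right]\longrightarrow 1\qquad (n\to\infty),$$ that is, $\omega(G)=O\left(\log n/(d+\log\log n)\right)$ asymptotically almost surely. -/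

import Mathlib

open MeasureTheory ProbabilityTheory Filter Topology Asymptotics

noncomputable section

namespace GIRG

/-- Outcomes of the random experiment: a weight and a position in the `d`-dimensional torus
`(ℝ/ℤ)^d` for each of the `n` vertices. -/
abbrev Sample (n d : ℕ) : Type := (Fin n → ℝ) × (Fin n → UnitAddTorus (Fin d))

/-- The law of the experiment: all weights and positions are independent, each weight is Pareto
distributed with `P(w ≤ x) = 1 - (x / w₀) ^ (1 - β)` for `x ≥ w₀` (scale `w₀`, shape `β - 1`), and
each position is uniform on the torus. -/
def law (n d : ℕ) (β w₀ : ℝ) : Measure (Sample n d) :=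
  (Measure.pi fun _ : Fin n => paretoMeasure w₀ (β - 1)).prod
    (Measure.pi fun _ : Fin n => (volume : Measure (UnitAddTorus (Fin d))))

/-- The connection threshold `(1 / 2) (lam * a * b / n) ^ (1 / d)` of two vertices of weights
`a` and `b`. -/
def threshold (n d : ℕ) (lam a b : ℝ) : ℝ :=
  (1 / 2) * (lam * a * b / n) ^ (1 / (d : ℝ))

/-- The standard geometric inhomogeneous random graph: distinct vertices are adjacent if and only
if their distance is at most their threshold. Here `dist` on `Fin d → ℝ/ℤ` is the maximum over the
coordinates of the distance on the circle of length `1`. -/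
def graph {n d : ℕ} (lam : ℝ) (s : Sample n d) : SimpleGraph (Fin n) where
  Adj u v := u ≠ v ∧ dist (s.2 u) (s.2 v) ≤ threshold n d lam (s.1 u) (s.1 v)
  symm := ⟨fun u v h => ⟨h.1.symm, by
    have h2 := h.2
    rw [dist_comm, threshold, mul_right_comm] at h2
    exact h2⟩⟩
  loopless := ⟨fun _ h => h.1 rfl⟩

end GIRG

end

namespace GIRG

open scoped ENNReal

/-! ### Geometry of the circle -/

/-! Consider the lightest vertex `v` of a clique, of weight `w`. The other members are at least as
heavy, and each falls into one of two classes. Those of weight at least `(11/10)^d * w` are rare: as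
`β > 3`, a random vertex is this heavy and within the threshold of `v` with probability `O((10/11)^d
/ n)` (`measure_heavy_le`). The lighter ones are pairwise at distance at most `R`, the `radius` at
`w`. In each coordinate they therefore fit into an arc of length `3R/2` rather than `2R`, centred at
one of two points (`exists_center`). So one of `2^d` boxes around `v` contains them all, and a
random vertex at least as heavy as `v` lies in a given box with probability `O((10/11)^d / n)`
(`measure_light_le`). If `R > 1/4`, then `w` is so large that the weight tail alone suffices. A
union bound over `v`, the box and the `k` other members gives at most `n 2^d (A (10/11)^d)^k / k!`.
Its logarithm is at most `2 log n - k (log k + c d - O(1))` with `c = log (11/10)`. For `k` of order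
`log n / (d + log log n)`, either `log k` or `c d` is of order `d + log log n`, so a large constant
makes the bound at most `1 / n`. -/

lemma exists_coe_eq_abs_eq_norm (x : UnitAddCircle) : ∃ t : ℝ, (t : UnitAddCircle) = x ∧ |t| = ‖x‖ := by
  induction x using QuotientAddGroup.induction_on with
  | H y =>
    refine ⟨y - round y, ?_, (UnitAddCircle.norm_eq).symm⟩
    have h : ((round y : ℝ) : UnitAddCircle) = 0 := by
      have := AddCircle.coe_eq_zero_iff (1 : ℝ) (x := (round y : ℝ))
      exact this.2 ⟨round y, by simp⟩
    rw [AddCircle.coe_sub, h, sub_zero]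

/-- A set of diameter at most `R` near `x` is contained in one of two balls of radius `3 R / 4`. -/
lemma exists_center {A : Set UnitAddCircle} {x : UnitAddCircle} {R : ℝ} (hR : R ≤ 1 / 4)
    (hx : ∀ a ∈ A, dist a x ≤ R) (hA : ∀ a ∈ A, ∀ b ∈ A, dist a b ≤ R) :
    ∃ j : Bool, ∀ a ∈ A,
      dist a (x + ((if j then R / 4 else -(R / 4) : ℝ) : UnitAddCircle)) ≤ 3 * R / 4 := by
  choose t ht hta using exists_coe_eq_abs_eq_norm
  have h1 : ∀ a ∈ A, |t (a - x)| ≤ R := fun a ha => by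
    rw [hta, ← dist_eq_norm]; exact hx a ha
  have h2 : ∀ a ∈ A, ∀ b ∈ A, |t (a - x) - t (b - x)| ≤ R := fun a ha b hb => by
    -- Both lifts lie in `[-R, R]` and `2R ≤ 1/2`, so their difference does not wrap around the
    -- circle.
    have e : ‖((t (a - x) - t (b - x) : ℝ) : UnitAddCircle)‖ = |t (a - x) - t (b - x)| := by
      rw [AddCircle.norm_coe_eq_abs_iff _ one_ne_zero]
      have := abs_le.1 (h1 a ha)
      have := abs_le.1 (h1 b hb)
      rw [abs_one, abs_le]
      constructor <;> linarith
    rw [← e, AddCircle.coe_sub, ht, ht, sub_sub_sub_cancel_right, ← dist_eq_norm]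
    exact hA a ha b hb
  have h3 : ∀ a ∈ A, ∀ c : ℝ, dist a (x + (c : UnitAddCircle)) ≤ |t (a - x) - c| :=
    fun a ha c => by
    have e : a - (x + (c : UnitAddCircle)) = ((t (a - x) - c : ℝ) : UnitAddCircle) := by
      rw [AddCircle.coe_sub, ht]; abel
    rw [dist_eq_norm, e, UnitAddCircle.norm_eq]
    simpa using round_le (t (a - x) - c) 0
  -- The lifts lie in `[-R, R]` and span at most `R`. Either all are at least `-R/2`, or one is
  -- below and then all are below `R/2`.
  by_cases h : ∀ a ∈ A, -(R / 2) ≤ t (a - x)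
  · refine ⟨true, fun a ha => (h3 a ha _).trans ?_⟩
    have := abs_le.1 (h1 a ha)
    have := h a ha
    simp only [if_true]
    rw [abs_le]
    constructor <;> linarith
  · push Not at h
    obtain ⟨b, hb, hbt⟩ := h
    refine ⟨false, fun a ha => (h3 a ha _).trans ?_⟩
    have := abs_le.1 (h1 a ha)
    have := abs_le.1 (h2 a ha b hb)
    simp only [Bool.false_eq_true, if_false]
    rw [abs_le]
    constructor <;> linarith

lemma volume_pi_closedBall_le {d : ℕ} (c : UnitAddTorus (Fin d)) {r : ℝ} (hr : 0 ≤ r) :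
    volume (Metric.closedBall c r) ≤ ENNReal.ofReal ((2 * r) ^ d) := by
  rw [MeasureTheory.volume_pi_closedBall c hr]
  calc ∏ i, volume (Metric.closedBall (c i) r)
      ≤ ∏ _i : Fin d, ENNReal.ofReal (2 * r) := by
        refine Finset.prod_le_prod' fun i _ => ?_
        rw [AddCircle.volume_closedBall]
        exact ENNReal.ofReal_le_ofReal (min_le_right _ _)
    _ = _ := by
        rw [Finset.prod_const, Finset.card_univ, Fintype.card_fin,
          ENNReal.ofReal_pow (by positivity)]

/-! ### Moments of the Pareto law -/

/-- Used with `p = 0` for the tail and `p = 1` for the truncated mean. -/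
lemma lintegral_Ici_rpow_paretoMeasure {t r a p : ℝ} (ht : 0 < t) (hr : 0 < r) (hp : p < r)
    (ha : t ≤ a) :
    ∫⁻ x in Set.Ici a, ENNReal.ofReal (x ^ p) ∂paretoMeasure t r
      = ENNReal.ofReal (r * t ^ r * a ^ (p - r) / (r - p)) := by
  have ha0 : 0 < a := ht.trans_le ha
  have hm : Measurable (paretoPDF t r) := (measurable_paretoPDFReal t r).ennreal_ofReal
  rw [paretoMeasure, restrict_withDensity measurableSet_Ici,
    lintegral_withDensity_eq_lintegral_mul _ hm (by fun_prop)]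
  have e : ∫⁻ x in Set.Ici a, (paretoPDF t r * fun x => ENNReal.ofReal (x ^ p)) x
      = ∫⁻ x in Set.Ici a, ENNReal.ofReal (r * t ^ r * x ^ (p - r - 1)) := by
    refine setLIntegral_congr_fun measurableSet_Ici fun x hx => ?_
    have hx0 : 0 < x := ha0.trans_le hx
    simp only [Pi.mul_apply]
    rw [paretoPDF_of_le (ha.trans hx), ← ENNReal.ofReal_mul (by positivity), mul_assoc,
      ← Real.rpow_add hx0]
    congr 3
    ring
  rw [e, Measure.restrict_congr_set Ioi_ae_eq_Ici.symm, ← ofReal_integral_eq_lintegral_ofReal]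
  · rw [integral_const_mul, integral_Ioi_rpow_of_lt (by linarith) ha0]
    congr 1
    have : r - p ≠ 0 := by linarith
    have h2 : p - r - 1 + 1 = -(r - p) := by ring
    rw [h2, neg_div_neg_eq, neg_sub]
    ring
  · exact (integrableOn_Ioi_rpow_of_lt (by linarith) ha0).const_mul _
  · refine (ae_restrict_iff' measurableSet_Ioi).2 (ae_of_all _ fun x hx => ?_)
    have hx0 : 0 < x := ha0.trans hx
    simp only [Pi.zero_apply]
    positivity

lemma paretoMeasure_Ici {t r a : ℝ} (ht : 0 < t) (hr : 0 < r) (ha : t ≤ a) :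
    paretoMeasure t r (Set.Ici a) = ENNReal.ofReal ((t / a) ^ r) := by
  have h := lintegral_Ici_rpow_paretoMeasure ht hr hr ha
  simp only [Real.rpow_zero, ENNReal.ofReal_one, lintegral_one, Measure.restrict_apply,
    MeasurableSet.univ, Set.univ_inter] at h
  rw [h, Real.div_rpow ht.le (ht.le.trans ha), zero_sub, Real.rpow_neg (ht.le.trans ha), sub_zero]
  congr 1
  field_simp

lemma ae_le_paretoMeasure {t r : ℝ} : ∀ᵐ x ∂paretoMeasure t r, t ≤ x := by
  have hs : {x : ℝ | ¬ t ≤ x} = Set.Iio t := by ext; simp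
  rw [ae_iff, hs, paretoMeasure, withDensity_apply _ measurableSet_Iio]
  exact lintegral_paretoPDF_of_le le_rfl

/-! ### Many points related to one point of an independent sample -/

section Sample

variable {α : Type*} [MeasurableSpace α] {ν : Measure α} [IsProbabilityMeasure ν]

lemma measure_pi_forall_mem_le {m : ℕ} (S : Finset (Fin m)) {B : Set α} {q : ℝ≥0∞}
    (hq : ν B ≤ q) :
    Measure.pi (fun _ : Fin m => ν) {y | ∀ u ∈ S, y u ∈ B} ≤ q ^ S.card := by
  have hs : {y : Fin m → α | ∀ u ∈ S, y u ∈ B}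
      = Set.pi Set.univ fun u => if u ∈ S then B else Set.univ := by
    ext y
    simp only [Set.mem_ofPred_eq, Set.mem_pi, Set.mem_univ, true_implies]
    refine forall_congr' fun u => ?_
    split_ifs with h <;> simp [h]
  rw [hs, Measure.pi_pi]
  calc ∏ u, ν (if u ∈ S then B else Set.univ) = ∏ u, if u ∈ S then ν B else 1 := by
        refine Finset.prod_congr rfl fun u _ => ?_
        split_ifs <;> simp
    _ = ν B ^ S.card := by rw [Finset.prod_ite_mem, Finset.univ_inter, Finset.prod_const]
    _ ≤ _ := by gcongr

/-- Given the value at `v`, the other points are still independent. The bound `hq` is needed only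
almost everywhere because it will hold only for weights at least `w₀`. -/
lemma measure_pi_star_le {m : ℕ} (v : Fin (m + 1)) (S : Finset (Fin m)) {T : Set (α × α)}
    (hT : MeasurableSet T) {q : ℝ≥0∞} (hq : ∀ᵐ z ∂ν, ν {y | (z, y) ∈ T} ≤ q) :
    Measure.pi (fun _ : Fin (m + 1) => ν) {ω | ∀ u ∈ S, (ω v, ω (v.succAbove u)) ∈ T}
      ≤ q ^ S.card := by
  let E : Set (α × (Fin m → α)) := {p | ∀ u ∈ S, (p.1, p.2 u) ∈ T}
  have hE : MeasurableSet E := by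
    have : E = ⋂ u ∈ S, (fun p : α × (Fin m → α) => (p.1, p.2 u)) ⁻¹' T := by
      ext p; simp [E]
    rw [this]
    exact Finset.measurableSet_biInter S fun u _ => hT.preimage (by fun_prop)
  have hmp := measurePreserving_piFinSuccAbove (fun _ : Fin (m + 1) => ν) v
  have hpre : {ω : Fin (m + 1) → α | ∀ u ∈ S, (ω v, ω (v.succAbove u)) ∈ T}
      = MeasurableEquiv.piFinSuccAbove (fun _ => α) v ⁻¹' E := by
    ext ω
    rfl
  rw [hpre, hmp.measure_preimage hE.nullMeasurableSet, Measure.prod_apply hE]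
  calc ∫⁻ z, Measure.pi (fun _ : Fin m => ν) (Prod.mk z ⁻¹' E) ∂ν
      ≤ ∫⁻ _z, q ^ S.card ∂ν := by
        refine lintegral_mono_ae ?_
        filter_upwards [hq] with z hz
        exact measure_pi_forall_mem_le S hz
    _ = _ := by simp

/-- Union bound: some point of an independent sample of size `n` has at least `k` related points. -/
lemma measure_pi_exists_star_le {ι : Type*} [Fintype ι] (n k : ℕ) {T : ι → Set (α × α)}
    (hT : ∀ j, MeasurableSet (T j)) {q : ℝ≥0∞} (hq : ∀ j, ∀ᵐ z ∂ν, ν {y | (z, y) ∈ T j} ≤ q) :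
    Measure.pi (fun _ : Fin n => ν)
      {ω | ∃ v, ∃ j, ∃ S : Finset (Fin n), S.card = k ∧ v ∉ S ∧ ∀ u ∈ S, (ω v, ω u) ∈ T j}
      ≤ n * (Fintype.card ι * (n.choose k * q ^ k)) := by
  obtain _ | m := n
  · have : {ω : Fin 0 → α | ∃ v, ∃ j, ∃ S : Finset (Fin 0), S.card = k ∧ v ∉ S ∧
        ∀ u ∈ S, (ω v, ω u) ∈ T j} = ∅ := by
      ext ω
      simp
    rw [this, measure_empty]
    exact zero_le
  calc _ ≤ Measure.pi (fun _ : Fin (m + 1) => ν) (⋃ v : Fin (m + 1), ⋃ j : ι,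
        ⋃ S ∈ (Finset.univ : Finset (Fin m)).powersetCard k,
          {ω | ∀ u ∈ S, (ω v, ω (v.succAbove u)) ∈ T j}) := by
        refine measure_mono ?_
        rintro ω ⟨v, j, S, hS, hv, h⟩
        simp only [Set.mem_iUnion, Finset.mem_powersetCard_univ]
        -- Since `v ∉ S`, the set `S` is the image under `v.succAbove` of a set of the same size.
        refine ⟨v, j, S.preimage v.succAbove Fin.succAbove_right_injective.injOn, ?_, ?_⟩
        · rw [← hS, Finset.card_preimage]
          congr 1
          refine Finset.filter_true_of_mem fun u hu => ?_
          rw [Fin.range_succAbove]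
          rintro rfl
          exact hv hu
        · intro u hu
          exact h _ (Finset.mem_preimage.1 hu)
    _ ≤ ∑ _v : Fin (m + 1), ∑ _j : ι,
          ∑ _S ∈ (Finset.univ : Finset (Fin m)).powersetCard k, q ^ k := by
        refine (measure_iUnion_fintype_le _ _).trans (Finset.sum_le_sum fun v _ => ?_)
        refine (measure_iUnion_fintype_le _ _).trans (Finset.sum_le_sum fun j _ => ?_)
        refine (measure_biUnion_finset_le _ _).trans (Finset.sum_le_sum fun S hS => ?_)
        have := measure_pi_star_le v S (hT j) (hq j)
        rwa [(Finset.mem_powersetCard_univ.1 hS)] at this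
    _ ≤ _ := by
        simp only [Finset.sum_const, Finset.card_univ, Finset.card_powersetCard, Fintype.card_fin,
          nsmul_eq_mul]
        gcongr
        exact Nat.le_succ m

end Sample

/-! ### The neighbourhood relation of a lightest clique vertex -/

lemma threshold_mono {n d : ℕ} {lam a b a' b' : ℝ} (hlam : 0 ≤ lam) (ha : 0 ≤ a) (hb : 0 ≤ b)
    (haa : a ≤ a') (hbb : b ≤ b') : threshold n d lam a b ≤ threshold n d lam a' b' := by
  have := ha.trans haa
  unfold threshold
  gcongr

lemma threshold_nonneg {n d : ℕ} {lam a b : ℝ} (hlam : 0 ≤ lam) (ha : 0 ≤ a) (hb : 0 ≤ b) :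
    0 ≤ threshold n d lam a b := by
  unfold threshold
  positivity

lemma two_mul_threshold_pow {n d : ℕ} (hd : d ≠ 0) {lam a b : ℝ} (hlam : 0 ≤ lam) (ha : 0 ≤ a)
    (hb : 0 ≤ b) : (2 * threshold n d lam a b) ^ d = lam * a * b / n := by
  unfold threshold
  rw [← mul_assoc, mul_one_div_cancel two_ne_zero, one_mul, one_div,
    Real.rpow_inv_natCast_pow (by positivity) hd]

/-- The connection threshold of two vertices of weight `(11 / 10) ^ d * w`. -/
noncomputable def radius (n d : ℕ) (lam w : ℝ) : ℝ := 121 / 100 * threshold n d lam w w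

/-- The `d`-th root turns the weight factor `(11/10)^(2d)` into a length factor `121/100`, small
enough that `3/4 * 121/100 < 10/11`. -/
lemma threshold_scaled {n d : ℕ} (hd : d ≠ 0) {lam w : ℝ} (hlam : 0 ≤ lam) (hw : 0 ≤ w) :
    threshold n d lam ((11 / 10) ^ d * w) ((11 / 10) ^ d * w) = radius n d lam w := by
  unfold radius threshold
  have e : lam * ((11 / 10) ^ d * w) * ((11 / 10) ^ d * w) / n
      = (121 / 100) ^ d * (lam * w * w / n) := by
    have : (121 / 100 : ℝ) = 11 / 10 * (11 / 10) := by norm_num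
    rw [this, mul_pow]
    ring
  rw [e, Real.mul_rpow (by positivity) (by positivity), one_div (d : ℝ),
    Real.pow_rpow_inv_natCast (by norm_num) hd]
  ring

/-- The point of the torus with all coordinates `± R / 4`, with signs given by `j`. -/
noncomputable def shift {d : ℕ} (j : Fin d → Bool) (R : ℝ) : UnitAddTorus (Fin d) :=
  fun i => ((if j i then R / 4 else -(R / 4) : ℝ) : UnitAddCircle)

/-- Pairs of a vertex and a heavier one, such that much heavier vertices satisfy the connection
condition and other ones lie, if the radius is small, in the box with index `j`. -/
def starRel (n d : ℕ) (lam : ℝ) (j : Fin d → Bool) :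
    Set ((ℝ × UnitAddTorus (Fin d)) × (ℝ × UnitAddTorus (Fin d))) :=
  {p | p.1.1 ≤ p.2.1 ∧
    ((11 / 10) ^ d * p.1.1 ≤ p.2.1 → dist p.2.2 p.1.2 ≤ threshold n d lam p.1.1 p.2.1) ∧
    (radius n d lam p.1.1 ≤ 1 / 4 → p.2.1 < (11 / 10) ^ d * p.1.1 →
      dist p.2.2 (p.1.2 + shift j (radius n d lam p.1.1)) ≤ 3 * radius n d lam p.1.1 / 4)}

lemma measurable_threshold (n d : ℕ) (lam : ℝ) :
    Measurable fun p : ℝ × ℝ => threshold n d lam p.1 p.2 := by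
  unfold threshold
  fun_prop

lemma measurable_radius (n d : ℕ) (lam : ℝ) : Measurable (radius n d lam) :=
  ((measurable_threshold n d lam).comp (measurable_id.prodMk measurable_id)).const_mul _

lemma measurable_shift {d : ℕ} (j : Fin d → Bool) : Measurable (shift j) := by
  refine measurable_pi_lambda _ fun i => AddCircle.measurable_mk'.comp ?_
  split_ifs <;> fun_prop

lemma measurableSet_starRel (n d : ℕ) (lam : ℝ) (j : Fin d → Bool) :
    MeasurableSet (starRel n d lam j) := by
  have hr := measurable_radius n d lam
  have hs := measurable_shift j
  have ht := measurable_threshold n d lam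
  have h1 : MeasurableSet {p : (ℝ × UnitAddTorus (Fin d)) × (ℝ × UnitAddTorus (Fin d)) |
      p.1.1 ≤ p.2.1} := measurableSet_le (by fun_prop) (by fun_prop)
  have h2 : MeasurableSet {p : (ℝ × UnitAddTorus (Fin d)) × (ℝ × UnitAddTorus (Fin d)) |
      (11 / 10) ^ d * p.1.1 ≤ p.2.1} := measurableSet_le (by fun_prop) (by fun_prop)
  have h3 : MeasurableSet {p : (ℝ × UnitAddTorus (Fin d)) × (ℝ × UnitAddTorus (Fin d)) |
      dist p.2.2 p.1.2 ≤ threshold n d lam p.1.1 p.2.1} :=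
    measurableSet_le (by fun_prop)
      (ht.comp ((measurable_fst.comp measurable_fst).prodMk (measurable_fst.comp measurable_snd)))
  have h4 : MeasurableSet {p : (ℝ × UnitAddTorus (Fin d)) × (ℝ × UnitAddTorus (Fin d)) |
      radius n d lam p.1.1 ≤ 1 / 4} := measurableSet_le (by fun_prop) (by fun_prop)
  have h5 : MeasurableSet {p : (ℝ × UnitAddTorus (Fin d)) × (ℝ × UnitAddTorus (Fin d)) |
      p.2.1 < (11 / 10) ^ d * p.1.1} := measurableSet_lt (by fun_prop) (by fun_prop)
  have h6 : MeasurableSet {p : (ℝ × UnitAddTorus (Fin d)) × (ℝ × UnitAddTorus (Fin d)) |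
      dist p.2.2 (p.1.2 + shift j (radius n d lam p.1.1)) ≤ 3 * radius n d lam p.1.1 / 4} :=
    measurableSet_le (by fun_prop) (by fun_prop)
  exact h1.inter ((h2.imp h3).inter (h4.imp (h5.imp h6)))

/-- A large clique yields a vertex (the lightest of the clique) with many related vertices. -/
lemma exists_star_of_lt_cliqueNum {n d : ℕ} (hd : d ≠ 0) {lam : ℝ} (hlam : 0 ≤ lam)
    {s : Sample n d} (hs : ∀ u, 0 ≤ s.1 u) {k : ℕ} (hk : k < (graph lam s).cliqueNum) :
    ∃ v, ∃ j, ∃ S : Finset (Fin n), S.card = k ∧ v ∉ S ∧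
      ∀ u ∈ S, ((s.1 v, s.2 v), (s.1 u, s.2 u)) ∈ starRel n d lam j := by
  obtain ⟨Q, hQ⟩ := (graph lam s).exists_isNClique_cliqueNum
  have hQne : Q.Nonempty := by
    rw [← Finset.card_pos, hQ.card_eq]; omega
  obtain ⟨v, hvQ, hvmin⟩ := Q.exists_min_image s.1 hQne
  obtain ⟨S, hSQ, hSk⟩ : ∃ S ⊆ Q.erase v, S.card = k := by
    refine Finset.exists_subset_card_eq ?_
    rw [Finset.card_erase_of_mem hvQ, hQ.card_eq]; omega
  have hSQ' : ∀ u ∈ S, u ∈ Q := fun u hu => Finset.mem_of_mem_erase (hSQ hu)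
  have hadj : ∀ u ∈ Q, ∀ u' ∈ Q, u ≠ u' →
      dist (s.2 u) (s.2 u') ≤ threshold n d lam (s.1 u) (s.1 u') := fun u hu u' hu' h =>
    (hQ.isClique hu hu' h).2
  set R := radius n d lam (s.1 v) with hRdef
  have hR0 : 0 ≤ R := mul_nonneg (by norm_num) (threshold_nonneg hlam (hs v) (hs v))
  have hlight : ∀ u ∈ Q, ∀ u' ∈ Q, s.1 u ≤ (11 / 10) ^ d * s.1 v → s.1 u' ≤ (11 / 10) ^ d * s.1 v →
      dist (s.2 u) (s.2 u') ≤ R := by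
    intro u hu u' hu' h h'
    by_cases e : u = u'
    · rw [e, dist_self]; exact hR0
    · refine (hadj u hu u' hu' e).trans ?_
      rw [hRdef, ← threshold_scaled hd hlam (hs v)]
      exact threshold_mono hlam (hs _) (hs _) h h'
  have hvl : s.1 v ≤ (11 / 10) ^ d * s.1 v :=
    le_mul_of_one_le_left (hs v) (one_le_pow₀ (by norm_num))
  have hbox : ∃ j : Fin d → Bool, R ≤ 1 / 4 → ∀ u ∈ Q, s.1 u ≤ (11 / 10) ^ d * s.1 v →
      dist (s.2 u) (s.2 v + shift j R) ≤ 3 * R / 4 := by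
    by_cases hR : R ≤ 1 / 4
    swap
    -- For `R > 1/4` the box condition is void and any index serves.
    · exact ⟨fun _ => true, fun h => absurd h hR⟩
    have hi : ∀ i : Fin d, ∃ j : Bool, ∀ u ∈ Q, s.1 u ≤ (11 / 10) ^ d * s.1 v →
        dist (s.2 u i) (s.2 v i + ((if j then R / 4 else -(R / 4) : ℝ) : UnitAddCircle))
          ≤ 3 * R / 4 := by
      intro i
      obtain ⟨j, hj⟩ := exists_center (x := s.2 v i)
        (A := {a | ∃ u ∈ Q, s.1 u ≤ (11 / 10) ^ d * s.1 v ∧ s.2 u i = a}) hR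
        (by
          rintro _ ⟨u, hu, hul, rfl⟩
          exact (dist_le_pi_dist _ _ i).trans (hlight u hu v hvQ hul hvl))
        (by
          rintro _ ⟨u, hu, hul, rfl⟩ _ ⟨u', hu', hul', rfl⟩
          exact (dist_le_pi_dist _ _ i).trans (hlight u hu u' hu' hul hul'))
      exact ⟨j, fun u hu hul => hj _ ⟨u, hu, hul, rfl⟩⟩
    choose j hj using hi
    exact ⟨j, fun _ u hu hul => (dist_pi_le_iff (by positivity)).2 fun i => hj i u hu hul⟩
  obtain ⟨j, hj⟩ := hbox
  refine ⟨v, j, S, hSk, fun h => Finset.notMem_erase v Q (hSQ h), fun u hu => ⟨?_, ?_, ?_⟩⟩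
  · exact hvmin u (hSQ' u hu)
  · intro _
    have h := hadj v hvQ u (hSQ' u hu) (Finset.ne_of_mem_erase (hSQ hu)).symm
    rwa [dist_comm] at h
  · exact fun hR hul => hj hR u (hSQ' u hu) hul.le

/-! ### The probability of being related -/

/-- At weight `x` the ball has volume at most `lam w x / n`. Integrating over `x ≥ a = (11/10)^d w`
leaves a multiple of `w a^(1-r) / n`, where `r > 2` bounds `w^(2-r)` and yields the factor
`(10/11)^d`. -/
lemma measure_heavy_le {n d : ℕ} (hd : d ≠ 0) {lam w₀ r w : ℝ} (hlam : 0 ≤ lam)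
    (hw₀ : 0 < w₀) (hr : 2 < r) (hw : w₀ ≤ w) (c : UnitAddTorus (Fin d)) :
    (paretoMeasure w₀ r).prod (volume : Measure (UnitAddTorus (Fin d)))
      {y | (11 / 10) ^ d * w ≤ y.1 ∧ dist y.2 c ≤ threshold n d lam w y.1}
      ≤ ENNReal.ofReal (2 * (lam * w₀ ^ 2 / n) * (10 / 11) ^ d) := by
  have := isProbabilityMeasure_paretoMeasure hw₀ (by linarith : 0 < r)
  have hwp : 0 < w := hw₀.trans_le hw
  set a := (11 / 10 : ℝ) ^ d * w with ha
  have hwa : w ≤ a := le_mul_of_one_le_left hwp.le (one_le_pow₀ (by norm_num))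
  have hap : 0 < a := hwp.trans_le hwa
  have ht := measurable_threshold n d lam
  have hms : MeasurableSet {y : ℝ × UnitAddTorus (Fin d) |
      a ≤ y.1 ∧ dist y.2 c ≤ threshold n d lam w y.1} := by
    have h1 : MeasurableSet {y : ℝ × UnitAddTorus (Fin d) | a ≤ y.1} :=
      measurableSet_le (by fun_prop) (by fun_prop)
    have h2 : MeasurableSet {y : ℝ × UnitAddTorus (Fin d) |
        dist y.2 c ≤ threshold n d lam w y.1} :=
      measurableSet_le (by fun_prop) (ht.comp (measurable_const.prodMk measurable_fst))
    exact h1.inter h2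
  rw [Measure.prod_apply hms]
  calc _ ≤ ∫⁻ x, (Set.Ici a).indicator
          (fun x => ENNReal.ofReal (lam * w / n) * ENNReal.ofReal (x ^ (1 : ℝ))) x
          ∂paretoMeasure w₀ r := by
        refine lintegral_mono fun x => ?_
        by_cases hx : a ≤ x
        · rw [Set.indicator_of_mem (show x ∈ Set.Ici a from hx)]
          have hx0 : 0 ≤ x := hap.le.trans hx
          rw [← ENNReal.ofReal_mul (by positivity), Real.rpow_one,
            show lam * w / n * x = lam * w * x / n by ring,
            ← two_mul_threshold_pow hd hlam hwp.le hx0]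
          refine le_trans (measure_mono ?_)
            (volume_pi_closedBall_le c (threshold_nonneg hlam hwp.le hx0))
          exact fun y hy => hy.2
        · have : Prod.mk x ⁻¹' {y : ℝ × UnitAddTorus (Fin d) |
              a ≤ y.1 ∧ dist y.2 c ≤ threshold n d lam w y.1} = ∅ := by
            ext y
            simp [hx]
          rw [this, measure_empty]
          exact zero_le
    _ = ENNReal.ofReal (lam * w / n) *
          ENNReal.ofReal (r * w₀ ^ r * a ^ (1 - r) / (r - 1)) := by
        rw [lintegral_indicator measurableSet_Ici, lintegral_const_mul _ (by fun_prop),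
          lintegral_Ici_rpow_paretoMeasure hw₀ (by linarith) (by linarith) (hw.trans hwa)]
    _ ≤ _ := by
        rw [← ENNReal.ofReal_mul (by positivity)]
        refine ENNReal.ofReal_le_ofReal ?_
        have h1 : w * a ^ (1 - r) ≤ (10 / 11) ^ d * w₀ ^ (2 - r) := by
          rw [ha, Real.mul_rpow (by positivity) hwp.le]
          have e1 : ((11 / 10 : ℝ) ^ d) ^ (1 - r) ≤ (10 / 11) ^ d := by
            calc ((11 / 10 : ℝ) ^ d) ^ (1 - r) ≤ ((11 / 10 : ℝ) ^ d) ^ (-1 : ℝ) :=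
                  Real.rpow_le_rpow_of_exponent_le (one_le_pow₀ (by norm_num)) (by linarith)
              _ = (10 / 11) ^ d := by
                  rw [Real.rpow_neg_one, ← inv_pow]; norm_num
          have e2 : w * w ^ (1 - r) ≤ w₀ ^ (2 - r) := by
            calc w * w ^ (1 - r) = w ^ (2 - r) := by
                  rw [← Real.rpow_one_add' hwp.le (by linarith)]; congr 1; ring
              _ ≤ w₀ ^ (2 - r) := Real.rpow_le_rpow_of_nonpos hw₀ hw (by linarith)
          calc w * (((11 / 10 : ℝ) ^ d) ^ (1 - r) * w ^ (1 - r))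
              = ((11 / 10 : ℝ) ^ d) ^ (1 - r) * (w * w ^ (1 - r)) := by ring
            _ ≤ _ := by gcongr
        have h2 : w₀ ^ r * w₀ ^ (2 - r) = w₀ ^ 2 := by
          rw [← Real.rpow_add hw₀, ← Real.rpow_natCast]; congr 1; push_cast; ring
        have h3 : r / (r - 1) ≤ 2 := by
          rw [div_le_iff₀ (by linarith)]; linarith
        have h4 : 0 < r - 1 := by linarith
        calc lam * w / n * (r * w₀ ^ r * a ^ (1 - r) / (r - 1))
            = r / (r - 1) * (lam / n) * w₀ ^ r * (w * a ^ (1 - r)) := by ring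
          _ ≤ 2 * (lam / n) * w₀ ^ r * ((10 / 11) ^ d * w₀ ^ (2 - r)) := by gcongr
          _ = 2 * (lam / n) * (w₀ ^ r * w₀ ^ (2 - r)) * (10 / 11) ^ d := by ring
          _ = _ := by rw [h2]; ring

lemma rpow_div_le {w₀ r w : ℝ} (hw₀ : 0 < w₀) (hr : 2 < r) (hw : w₀ ≤ w) :
    (w₀ / w) ^ r ≤ (w₀ / w) ^ 2 := by
  have hwp : 0 < w := hw₀.trans_le hw
  rw [← Real.rpow_natCast]
  exact Real.rpow_le_rpow_of_exponent_ge (by positivity) ((div_le_one hwp).2 hw)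
    (by push_cast; exact hr.le)

/-- The weight tail, at most `(w₀ / w)^2`, cancels the `w^2` in the volume of the box. What remains
is `(363/400)^d ≤ (10/11)^d`. -/
lemma measure_light_le {n d : ℕ} (hd : d ≠ 0) {lam w₀ r w : ℝ} (hlam : 0 ≤ lam)
    (hw₀ : 0 < w₀) (hr : 2 < r) (hw : w₀ ≤ w) (c : UnitAddTorus (Fin d)) :
    (paretoMeasure w₀ r).prod (volume : Measure (UnitAddTorus (Fin d)))
      {y | w ≤ y.1 ∧ dist y.2 c ≤ 3 * radius n d lam w / 4}
      ≤ ENNReal.ofReal (lam * w₀ ^ 2 / n * (10 / 11) ^ d) := by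
  have hwp : 0 < w := hw₀.trans_le hw
  have hR : 0 ≤ 3 * radius n d lam w / 4 :=
    div_nonneg (mul_nonneg (by norm_num) (mul_nonneg (by norm_num)
      (threshold_nonneg hlam hwp.le hwp.le))) (by norm_num)
  have hs : {y : ℝ × UnitAddTorus (Fin d) | w ≤ y.1 ∧ dist y.2 c ≤ 3 * radius n d lam w / 4}
      = Set.Ici w ×ˢ Metric.closedBall c (3 * radius n d lam w / 4) := rfl
  have := isProbabilityMeasure_paretoMeasure hw₀ (by linarith : 0 < r)
  rw [hs, Measure.prod_prod, paretoMeasure_Ici hw₀ (by linarith) hw]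
  calc _ ≤ ENNReal.ofReal ((w₀ / w) ^ 2) *
        ENNReal.ofReal ((2 * (3 * radius n d lam w / 4)) ^ d) := by
        gcongr
        · exact rpow_div_le hw₀ hr hw
        · exact volume_pi_closedBall_le c hR
    _ ≤ _ := by
        rw [← ENNReal.ofReal_mul (by positivity)]
        refine ENNReal.ofReal_le_ofReal ?_
        have e : 2 * (3 * radius n d lam w / 4)
            = 363 / 400 * (2 * threshold n d lam w w) := by
          rw [radius]; ring
        rw [e, mul_pow, two_mul_threshold_pow hd hlam hwp.le hwp.le]
        calc (w₀ / w) ^ 2 * ((363 / 400) ^ d * (lam * w * w / n))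
            = lam * w₀ ^ 2 / n * (363 / 400) ^ d := by field_simp
          _ ≤ _ := mul_le_mul_of_nonneg_left
              (pow_le_pow_left₀ (by norm_num) (by norm_num) d) (by positivity)

/-- A large radius forces `w^2 ≥ n / (4^d lam)`, hence a small tail. -/
lemma rpow_div_le_of_lt_radius {n d : ℕ} (hn : n ≠ 0) (hd : d ≠ 0) {lam w₀ r w : ℝ}
    (hlam : 0 ≤ lam) (hw₀ : 0 < w₀) (hr : 2 < r) (hw : w₀ ≤ w) (hR : 1 / 4 < radius n d lam w) :
    (w₀ / w) ^ r ≤ (lam * w₀ ^ 2 * 4 ^ d / n) ^ (r / 2) := by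
  have hwp : 0 < w := hw₀.trans_le hw
  have h1 : (1 / 4 : ℝ) ≤ 2 * threshold n d lam w w := by
    rw [radius] at hR; linarith
  have h2 : (1 / 4 : ℝ) ^ d ≤ lam * w * w / n := by
    rw [← two_mul_threshold_pow hd hlam hwp.le hwp.le]
    gcongr
  have hn' : (0 : ℝ) < n := by positivity
  have h3 : (w₀ / w) ^ 2 ≤ lam * w₀ ^ 2 * 4 ^ d / n := by
    rw [one_div, inv_pow, le_div_iff₀ hn', inv_mul_le_iff₀ (by positivity)] at h2
    rw [div_pow, div_le_div_iff₀ (by positivity) hn']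
    calc w₀ ^ 2 * n ≤ w₀ ^ 2 * (4 ^ d * (lam * w * w)) := by gcongr
      _ = _ := by ring
  calc (w₀ / w) ^ r = ((w₀ / w) ^ 2) ^ (r / 2) := by
        rw [← Real.rpow_natCast, ← Real.rpow_mul (by positivity)]
        congr 1; push_cast; ring
    _ ≤ _ := Real.rpow_le_rpow (by positivity) h3 (by linarith)

instance isProbabilityMeasure_volume_unitAddTorus (d : ℕ) :
    IsProbabilityMeasure (volume : Measure (UnitAddTorus (Fin d))) where
  measure_univ := by
    rw [volume_pi, Measure.pi_univ]
    exact Finset.prod_eq_one fun _ _ => UnitAddCircle.measure_univ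

lemma measure_starRel_le {n d : ℕ} (hn : n ≠ 0) (hd : d ≠ 0) {lam w₀ r : ℝ} (hlam : 0 ≤ lam)
    (hw₀ : 0 < w₀) (hr : 2 < r) (j : Fin d → Bool)
    (hnd : (lam * w₀ ^ 2 * 4 ^ d / n) ^ (r / 2) ≤ 3 * (lam * w₀ ^ 2 / n) * (10 / 11) ^ d)
    {z : ℝ × UnitAddTorus (Fin d)} (hz : w₀ ≤ z.1) :
    (paretoMeasure w₀ r).prod (volume : Measure (UnitAddTorus (Fin d)))
      {y | (z, y) ∈ starRel n d lam j}
      ≤ ENNReal.ofReal (3 * (lam * w₀ ^ 2 / n) * (10 / 11) ^ d) := by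
  by_cases hR : radius n d lam z.1 ≤ 1 / 4
  · calc _ ≤ (paretoMeasure w₀ r).prod (volume : Measure (UnitAddTorus (Fin d)))
          ({y | (11 / 10) ^ d * z.1 ≤ y.1 ∧ dist y.2 z.2 ≤ threshold n d lam z.1 y.1} ∪
          {y | z.1 ≤ y.1 ∧ dist y.2 (z.2 + shift j (radius n d lam z.1))
            ≤ 3 * radius n d lam z.1 / 4}) := by
          refine measure_mono fun y hy => ?_
          obtain ⟨h1, h2, h3⟩ := hy
          rcases le_or_gt ((11 / 10) ^ d * z.1) y.1 with h | h
          · exact Or.inl ⟨h, h2 h⟩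
          · exact Or.inr ⟨h1, h3 hR h⟩
      _ ≤ ENNReal.ofReal (2 * (lam * w₀ ^ 2 / n) * (10 / 11) ^ d) +
          ENNReal.ofReal (lam * w₀ ^ 2 / n * (10 / 11) ^ d) :=
          (measure_union_le _ _).trans (add_le_add (measure_heavy_le hd hlam hw₀ hr hz _)
            (measure_light_le hd hlam hw₀ hr hz _))
      _ = _ := by
          rw [← ENNReal.ofReal_add (by positivity) (by positivity)]
          congr 1; ring
  · have := isProbabilityMeasure_paretoMeasure hw₀ (by linarith : 0 < r)
    calc _ ≤ (paretoMeasure w₀ r).prod (volume : Measure (UnitAddTorus (Fin d)))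
          (Set.Ici z.1 ×ˢ Set.univ) := measure_mono fun y hy => ⟨hy.1, trivial⟩
      _ = ENNReal.ofReal ((w₀ / z.1) ^ r) := by
          rw [Measure.prod_prod, measure_univ, mul_one, paretoMeasure_Ici hw₀ (by linarith) hz]
      _ ≤ _ := ENNReal.ofReal_le_ofReal
          ((rpow_div_le_of_lt_radius hn hd hlam hw₀ hr hz (not_le.1 hR)).trans hnd)

/-- The probability of a clique with more than `k` vertices. -/
lemma law_lt_cliqueNum_le {n d : ℕ} (hn : n ≠ 0) (hd : d ≠ 0) {lam w₀ β : ℝ} (hlam : 0 ≤ lam)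
    (hw₀ : 0 < w₀) (hβ : 3 < β) (k : ℕ)
    (hnd : (lam * w₀ ^ 2 * 4 ^ d / n) ^ ((β - 1) / 2) ≤ 3 * (lam * w₀ ^ 2 / n) * (10 / 11) ^ d) :
    law n d β w₀ {s | k < (graph lam s).cliqueNum}
      ≤ ENNReal.ofReal (n * 2 ^ d *
          ((3 * lam * w₀ ^ 2 * (10 / 11) ^ d) ^ k / k.factorial)) := by
  have := isProbabilityMeasure_paretoMeasure hw₀ (by linarith : 0 < β - 1)
  set ν := (paretoMeasure w₀ (β - 1)).prod (volume : Measure (UnitAddTorus (Fin d))) with hν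
  have hae : ∀ᵐ z ∂ν, w₀ ≤ z.1 := Measure.quasiMeasurePreserving_fst.ae ae_le_paretoMeasure
  have hae' : ∀ᵐ ω ∂Measure.pi (fun _ : Fin n => ν), ∀ u, w₀ ≤ (ω u).1 :=
    ae_all_iff.2 fun u => (Measure.quasiMeasurePreserving_eval (fun _ => ν) u).ae hae
  have hmp := measurePreserving_arrowProdEquivProdArrow ℝ (UnitAddTorus (Fin d)) (Fin n)
    (fun _ => paretoMeasure w₀ (β - 1)) (fun _ => volume)
  -- Regroup the sample as `n` independent pairs of weight and position.
  rw [law, ← hmp.measure_preimage_equiv]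
  set q : ℝ := 3 * (lam * w₀ ^ 2 / n) * (10 / 11) ^ d with hq
  have hq0 : 0 ≤ q := by positivity
  calc _ ≤ Measure.pi (fun _ : Fin n => ν) {ω | ∃ v, ∃ j, ∃ S : Finset (Fin n), S.card = k ∧
        v ∉ S ∧ ∀ u ∈ S, (ω v, ω u) ∈ starRel n d lam j} := by
        refine measure_mono_ae ?_
        filter_upwards [hae'] with ω hω hk
        exact exists_star_of_lt_cliqueNum hd hlam (fun u => hw₀.le.trans (hω u)) hk
    _ ≤ n * (Fintype.card (Fin d → Bool) * (n.choose k * ENNReal.ofReal q ^ k)) := by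
        refine measure_pi_exists_star_le n k (measurableSet_starRel n d lam) fun j => ?_
        filter_upwards [hae] with z hz
        exact measure_starRel_le hn hd hlam hw₀ (by linarith) j hnd hz
    _ = ENNReal.ofReal (n * 2 ^ d * (n.choose k * q ^ k)) := by
        rw [ENNReal.ofReal_mul (p := (n : ℝ) * 2 ^ d) (by positivity),
          ENNReal.ofReal_mul (p := (n : ℝ)) (by positivity),
          ENNReal.ofReal_mul (p := (n.choose k : ℝ)) (by positivity), ENNReal.ofReal_pow hq0, ENNReal.ofReal_natCast,
          ENNReal.ofReal_natCast, ENNReal.ofReal_pow (by norm_num), mul_assoc]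
        simp
    _ ≤ _ := by
        refine ENNReal.ofReal_le_ofReal (mul_le_mul_of_nonneg_left ?_ (by positivity))
        calc (n.choose k : ℝ) * q ^ k ≤ n ^ k / k.factorial * q ^ k := by
              gcongr; exact Nat.choose_le_pow_div k n
          _ = (n * q) ^ k / k.factorial := by rw [mul_pow]; ring
          _ = _ := by
              have : (n : ℝ) ≠ 0 := by exact_mod_cast hn
              rw [hq]; congr 2; field_simp

/-! ### Asymptotics -/

/-- Here `L = log n`, `c = log (11/10)` and `a = 1 + log A`. With `ℓ = log L`, the bracket is at
least `m (d + ℓ)`: through `log k ≥ ℓ/2` if `d ≤ ℓ`, through `c d` otherwise. As `k ≥ x/2`, the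
choice `C = 6 / m` yields `3L`. -/
lemma three_mul_le_floor_mul {L c a x : ℝ} {d : ℕ} (hL : 0 < L) (hℓ : 1 ≤ Real.log L)
    (ha : 4 * a ≤ Real.log L) (hca : a ≤ c / 2 * Real.log L) (hc : 0 < c) (hdL : d ≤ L)
    {C : ℝ} (hC : C = 6 / min (1 / 8) (c / 4)) (hx : x = C * (L / (d + Real.log L))) :
    1 ≤ ⌊x⌋₊ ∧ 3 * L ≤ ⌊x⌋₊ * (Real.log ⌊x⌋₊ + c * d - a) := by
  set ℓ := Real.log L with hℓdef
  set m := min (1 / 8) (c / 4) with hm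
  have hm0 : 0 < m := lt_min (by norm_num) (by positivity)
  have hm1 : m ≤ 1 / 8 := min_le_left _ _
  have hm2 : m ≤ c / 4 := min_le_right _ _
  have hC48 : 48 ≤ C := by
    rw [hC, le_div_iff₀ hm0]; linarith
  have hℓL : ℓ ≤ L := (Real.log_le_sub_one_of_pos hL).trans (by linarith)
  have hd0 : (0 : ℝ) ≤ d := d.cast_nonneg
  have hD : 0 < d + ℓ := by linarith
  have hxD : x * (d + ℓ) = C * L := by
    rw [hx]; field_simp
  -- Ensures that rounding down loses at most half of `x`.
  have hx2 : 2 ≤ x := by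
    by_contra h
    have : x * (d + ℓ) ≤ 2 * (L + L) :=
      mul_le_mul (not_le.1 h).le (add_le_add hdL hℓL) hD.le (by norm_num)
    have : 48 * L ≤ C * L := by gcongr
    linarith
  have hk : x / 2 ≤ ⌊x⌋₊ := by
    have := Nat.lt_floor_add_one x
    linarith
  have hk1 : (1 : ℝ) ≤ ⌊x⌋₊ := by linarith
  have hlogk : 0 ≤ Real.log ⌊x⌋₊ := Real.log_nonneg hk1
  have key : m * (d + ℓ) ≤ Real.log ⌊x⌋₊ + c * d - a := by
    rcases le_or_gt (d : ℝ) ℓ with h | h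
    · have h1 : L / ℓ ≤ ⌊x⌋₊ := by
        refine le_trans ?_ hk
        rw [div_le_iff₀ (by linarith)]
        have : x * (d + ℓ) ≤ x * (2 * ℓ) := by gcongr; linarith
        have : 48 * L ≤ C * L := by gcongr
        linarith
      have h2 : ℓ - Real.log ℓ ≤ Real.log ⌊x⌋₊ := by
        rw [hℓdef, ← Real.log_div hL.ne' (by linarith)]
        exact Real.log_le_log (by positivity) h1
      have h3 : Real.log ℓ ≤ ℓ / 2 := by
        have e : Real.log ℓ = Real.log 2 + Real.log (ℓ / 2) := by
          rw [← Real.log_mul (by norm_num) (by positivity)]; congr 1; ring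
        have := Real.log_le_sub_one_of_pos (show 0 < ℓ / 2 by linarith)
        have := Real.log_two_lt_d9
        linarith
      have h4 : m * (d + ℓ) ≤ 1 / 8 * (ℓ + ℓ) := by gcongr
      have h5 : 0 ≤ c * d := by positivity
      linarith
    · have h1 : m * (d + ℓ) ≤ c / 4 * (d + d) := by gcongr
      have h2 : c / 2 * ℓ ≤ c / 2 * d := by gcongr
      linarith
  refine ⟨by exact_mod_cast hk1, ?_⟩
  calc 3 * L = x / 2 * (m * (d + ℓ)) := by
        rw [show x / 2 * (m * (d + ℓ)) = m * (x * (d + ℓ)) / 2 by ring, hxD, hC]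
        field_simp; norm_num
    _ ≤ _ := by gcongr

lemma pow_div_factorial_le {a : ℝ} (ha : 0 < a) {k : ℕ} (hk : 1 ≤ k) :
    a ^ k / k.factorial ≤ Real.exp (k * (Real.log a + 1 - Real.log k)) := by
  have hk0 : (0 : ℝ) < k := by exact_mod_cast hk
  have h1 := Real.pow_div_factorial_le_exp (k : ℝ) hk0.le k
  calc a ^ k / k.factorial = (a / k) ^ k * ((k : ℝ) ^ k / k.factorial) := by
        rw [div_pow]; field_simp
    _ ≤ (a / k) ^ k * Real.exp k := by gcongr
    _ = _ := by
        rw [← Real.exp_log (show 0 < a / k by positivity), ← Real.exp_nat_mul, ← Real.exp_add,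
          Real.log_div ha.ne' hk0.ne']
        congr 1; ring

/-- Of the three `log n`, two pay for `n 2^d ≤ n^2` and one remains. -/
lemma bound_le_inv {n d k : ℕ} (hn : n ≠ 0) (hk : 1 ≤ k) {A : ℝ} (hA : 0 < A)
    (hd : (d : ℝ) ≤ Real.log n)
    (h : 3 * Real.log n ≤ k * (Real.log k + Real.log (11 / 10) * d - (1 + Real.log A))) :
    n * 2 ^ d * ((A * (10 / 11) ^ d) ^ k / k.factorial) ≤ (n : ℝ)⁻¹ := by
  have hn0 : (0 : ℝ) < n := by positivity
  have h1 : (2 : ℝ) ^ d ≤ n := by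
    calc (2 : ℝ) ^ d ≤ Real.exp 1 ^ d := by
          gcongr; linarith [Real.add_one_le_exp 1]
      _ = Real.exp d := by rw [← Real.exp_nat_mul, mul_one]
      _ ≤ n := by rw [← Real.le_log_iff_exp_le hn0]; exact hd
  have h2 : Real.log (A * (10 / 11) ^ d) = Real.log A - Real.log (11 / 10) * d := by
    rw [Real.log_mul hA.ne' (by positivity), Real.log_pow,
      show (10 / 11 : ℝ) = (11 / 10)⁻¹ by norm_num, Real.log_inv]
    ring
  have h3 : (A * (10 / 11) ^ d) ^ k / k.factorial ≤ ((n : ℝ) ^ 3)⁻¹ := by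
    refine (pow_div_factorial_le (by positivity) hk).trans ?_
    rw [← Real.le_log_iff_exp_le (by positivity), Real.log_inv, Real.log_pow, h2]
    push_cast
    linarith
  calc n * 2 ^ d * ((A * (10 / 11) ^ d) ^ k / k.factorial)
      ≤ n * n * ((n : ℝ) ^ 3)⁻¹ := by gcongr
    _ = _ := by field_simp

/-- The gain `n^(p-1)` beats `4^(p d) (11/10)^d = exp (K d) = n^(o(1))`. Half of its exponent pays
for `K d`, half for the constants. -/
lemma eventually_rpow_le {a p : ℝ} (ha : 0 < a) (hp : 1 < p) {d : ℕ → ℕ}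
    (hd : (fun n : ℕ => (d n : ℝ)) =o[atTop] fun n : ℕ => Real.log n) :
    ∀ᶠ n : ℕ in atTop, (a * 4 ^ d n / n) ^ p ≤ 3 * (a / n) * (10 / 11) ^ d n := by
  set K := p * Real.log 4 + Real.log (11 / 10) with hK
  have hK0 : 0 < K := by
    have := Real.log_pos (show (1 : ℝ) < 4 by norm_num)
    have := Real.log_pos (show (1 : ℝ) < 11 / 10 by norm_num)
    positivity
  have hL : Tendsto (fun n : ℕ => Real.log n) atTop atTop :=
    Real.tendsto_log_atTop.comp tendsto_natCast_atTop_atTop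
  have hδ : 0 < (p - 1) / 2 := by linarith
  filter_upwards [hd.def (show 0 < (p - 1) / 2 / K by positivity),
    (hL.const_mul_atTop hδ).eventually_ge_atTop (p * Real.log a - Real.log (3 * a)),
    eventually_gt_atTop 1] with n h1 h2 hn
  have hn0 : (0 : ℝ) < n := by positivity
  rw [Real.norm_of_nonneg (by positivity), Real.norm_of_nonneg (Real.log_natCast_nonneg n),
    div_mul_eq_mul_div, le_div_iff₀ hK0] at h1
  rw [← Real.log_le_log_iff (by positivity) (by positivity), Real.log_rpow (by positivity),
    Real.log_div (by positivity) hn0.ne', Real.log_mul ha.ne' (by positivity), Real.log_pow,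
    show 3 * (a / n) * (10 / 11 : ℝ) ^ d n = 3 * a / n * ((11 / 10) ^ d n)⁻¹ by
      rw [← inv_pow]; norm_num; ring,
    Real.log_mul (by positivity) (by positivity), Real.log_inv, Real.log_pow,
    Real.log_div (by positivity) hn0.ne']
  rw [hK] at h1
  linarith

end GIRG

theorem mainTheorem11 (β w₀ lam : ℝ) (hβ : 3 < β) (hw₀ : 0 < w₀) (hlam : 0 < lam) :
    ∃ C : ℝ, 0 < C ∧
      ∀ d : ℕ → ℕ, (∀ n, 1 ≤ d n) →
        ((fun n : ℕ => (d n : ℝ)) =o[atTop] fun n : ℕ => Real.log n) →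
        Tendsto
          (fun n : ℕ => GIRG.law n (d n) β w₀
            {s | ((GIRG.graph lam s).cliqueNum : ℝ)
              ≤ C * (Real.log n / (d n + Real.log (Real.log n)))})
          atTop (𝓝 1) := by

  set c := Real.log (11 / 10) with hc
  have hc0 : 0 < c := Real.log_pos (by norm_num)
  set A := 3 * lam * w₀ ^ 2 with hA
  have hA0 : 0 < A := by positivity
  set C := 6 / min (1 / 8) (c / 4) with hC
  have hC0 : 0 < C := div_pos (by norm_num) (lt_min (by norm_num) (by positivity))
  refine ⟨C, hC0, fun d hd1 hd => ?_⟩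
  have hL : Tendsto (fun n : ℕ => Real.log n) atTop atTop :=
    Real.tendsto_log_atTop.comp tendsto_natCast_atTop_atTop
  have hLL := Real.tendsto_log_atTop.comp hL
  have hp : ∀ n, IsProbabilityMeasure (GIRG.law n (d n) β w₀) := fun n => by
    have := isProbabilityMeasure_paretoMeasure hw₀ (by linarith : 0 < β - 1)
    unfold GIRG.law
    infer_instance
  have hlim : Tendsto (fun n : ℕ => 1 - ENNReal.ofReal ((n : ℝ)⁻¹)) atTop (𝓝 1) := by
    have h := ENNReal.tendsto_ofReal (tendsto_inv_atTop_nhds_zero_nat (𝕜 := ℝ))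
    simpa using ENNReal.Tendsto.sub tendsto_const_nhds h (Or.inl ENNReal.one_ne_top)
  refine tendsto_of_tendsto_of_tendsto_of_le_of_le' hlim tendsto_const_nhds ?_
    (Eventually.of_forall fun n => prob_le_one)
  filter_upwards [hd.def one_pos, eventually_gt_atTop 1, hL.eventually_gt_atTop 0,
    hLL.eventually_ge_atTop 1, hLL.eventually_ge_atTop (4 * (1 + Real.log A)),
    (hLL.const_mul_atTop (half_pos hc0)).eventually_ge_atTop (1 + Real.log A),
    GIRG.eventually_rpow_le (a := lam * w₀ ^ 2) (p := (β - 1) / 2) (by positivity) (by linarith) hd]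
    with n hdn hn hLn hℓ hℓA hℓc hnd
  rw [Real.norm_of_nonneg (by positivity), Real.norm_of_nonneg hLn.le, one_mul] at hdn
  set x := C * (Real.log n / (d n + Real.log (Real.log n))) with hx
  obtain ⟨hk1, hk⟩ := GIRG.three_mul_le_floor_mul hLn hℓ hℓA hℓc hc0 hdn hC hx
  have hbad : GIRG.law n (d n) β w₀ {s | ⌊x⌋₊ < (GIRG.graph lam s).cliqueNum}
      ≤ ENNReal.ofReal ((n : ℝ)⁻¹) :=
    (GIRG.law_lt_cliqueNum_le (by omega) (Nat.one_le_iff_ne_zero.1 (hd1 n)) hlam.le hw₀ hβ _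
      hnd).trans (ENNReal.ofReal_le_ofReal (GIRG.bound_le_inv (by omega) hk1 hA0 hdn hk))
  have hx0 : 0 ≤ x := by
    by_contra h
    rw [Nat.floor_of_nonpos (not_le.1 h).le] at hk1
    omega
  rw [tsub_le_iff_right]
  -- Subadditivity is applied instead of taking complements, so the clique event need not be
  -- measurable.
  calc 1 = GIRG.law n (d n) β w₀ Set.univ := measure_univ.symm
    _ ≤ GIRG.law n (d n) β w₀ ({s | ((GIRG.graph lam s).cliqueNum : ℝ) ≤ x} ∪
          {s | ⌊x⌋₊ < (GIRG.graph lam s).cliqueNum}) := by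
        refine measure_mono fun s _ => ?_
        rcases le_or_gt ((GIRG.graph lam s).cliqueNum : ℝ) x with h | h
        · exact Or.inl h
        · exact Or.inr ((Nat.floor_lt hx0).2 h)
    _ ≤ _ := (measure_union_le _ _).trans (add_le_add le_rfl hbad)
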